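/- Let $d\ge 1$. Let $\Omega\subset\mathbb{R}^d$ be open and bounded with Lipschitz boundary (near each boundary point, $\Omega$ is, in suitable Cartesian coordinates, the set strictly above the graph of a Lipschitz function), and suppose that $\Omega$ satisfies an interior cone condition: there are a radius $\mathcal{R}>0$ and an angle $\nu\in(0,\pi/2)$ such that for every $x\in\Omega$ there is a unit vector $\xi$ with $\{x+ty : 0\le t\le \mathcal{R},\ \|y\|=1,\ y\cdot\xi\ge\cos\nu\}\subset\Omega$. Then there is a finite constant $C_P$ depending only on the shape and size of $\Omega$ (that is, only on $\Omega$ up to congruence) with the following property. Let $m\ge 2$ be an integer and let $u\in W^m_\infty(\Omega)$ be real-valued, i.e. all weak derivatives of $u$ of order at most $m$ exist and belong to $L_\infty(\Omega)$. Suppose that $u$ solves $$-\Delta u=f \ \text{ in } \Omega,\qquad u=g \ \text{ on } \partial\Omega,$$ for some functions $f$ on $\Omega$ and $g$ on $\partial\Omega$, where the equation holds almost everywhere in $\Omega$ and the boundary values are taken in the sense of traces: $\lim_{r\to0^+}\frac{1}{|\Omega\cap B(x,r)|}\int_{\Omega\cap B(x,r)}|u(y)-g(x)|\,dy=0$ for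 almost every $x\in\partial\Omega$ with respect to the surface measure. Then $$\|u\|_{L_2(\Omega)}\le C_P\,\max\bigl(\|\Delta u\|_{L_\infty(\Omega)},\ \|u\|_{L_\infty(\partial\Omega)}\bigr),$$ where $\|u\|_{L_\infty(\partial\Omega)}$ is the essential supremum, with respect to the surface measure, of the absolute value of the trace of $u$ on $\partial\Omega$. -/

import Mathlib

open MeasureTheory Filter Topology Set
open scoped ENNReal NNReal ContDiff

noncomputable section

namespace PoissonEstimate

/-- `ℝ^d` with the Euclidean norm. -/
abbrev E (d : ℕ) := EuclideanSpace ℝ (Fin d)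

variable {d : ℕ}

/-! ### Domains -/

/-- `∂Ω` is Lipschitz: near each boundary point, `Ω` is the set strictly above the graph of a
Lipschitz function `γ`, in a direction `e` (a unit vector). The function `γ` is only evaluated at
`y - ⟨e, y⟩ e`, the orthogonal projection of `y` to the hyperplane `e^⊥`. -/
def HasLipschitzBoundary (Ω : Set (E d)) : Prop :=
  ∀ x ∈ frontier Ω, ∃ r : ℝ, 0 < r ∧ ∃ e : E d, ‖e‖ = 1 ∧
    ∃ (K : ℝ≥0) (γ : E d → ℝ), LipschitzWith K γ ∧
      Ω ∩ Metric.ball x r =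
        {y | γ (y - inner ℝ e y • e) < inner ℝ e y} ∩ Metric.ball x r

/-- The cone with vertex `x`, axis direction `ξ`, angle `ν` and radius `R`. -/
def cone (x ξ : E d) (ν R : ℝ) : Set (E d) :=
  {z | ∃ (y : E d) (t : ℝ), ‖y‖ = 1 ∧ Real.cos ν ≤ inner ℝ y ξ ∧ t ∈ Icc 0 R ∧ z = x + t • y}

/-- Interior cone condition with radius `R` and angle `ν`. -/
def InteriorConeCondition (Ω : Set (E d)) (R ν : ℝ) : Prop :=
  ∀ x ∈ Ω, ∃ ξ : E d, ‖ξ‖ = 1 ∧ cone x ξ ν R ⊆ Ω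

/-- Open bounded sets with Lipschitz boundary that satisfy an interior cone condition. -/
structure IsAdmissibleDomain (Ω : Set (E d)) : Prop where
  isOpen : IsOpen Ω
  isBounded : Bornology.IsBounded Ω
  lipschitz : HasLipschitzBoundary Ω
  cone : ∃ R ν : ℝ, 0 < R ∧ 0 < ν ∧ ν < Real.pi / 2 ∧ InteriorConeCondition Ω R ν

/-! ### Weak derivatives and Sobolev spaces -/

/-- The classical partial derivative `∂φ/∂x_i`. -/
def partialDeriv (i : Fin d) (φ : E d → ℝ) : E d → ℝ :=
  fun x => fderiv ℝ φ x (EuclideanSpace.single i 1)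

/-- The classical derivative `∂^|α| φ / ∂x^α` for a multi-index `α`. -/
def multiDeriv (α : Fin d → ℕ) (φ : E d → ℝ) : E d → ℝ :=
  (List.finRange d).foldr (fun i ψ => (partialDeriv i)^[α i] ψ) φ

/-- `φ ∈ C_c^∞(Ω)`. -/
structure IsTestFunction (Ω : Set (E d)) (φ : E d → ℝ) : Prop where
  smooth : ContDiff ℝ ∞ φ
  compact : HasCompactSupport φ
  support : tsupport φ ⊆ Ω

/-- `v` is the weak derivative of `u` in `Ω` for the multi-index `α`. -/
structure HasWeakDeriv (Ω : Set (E d)) (α : Fin d → ℕ) (u v : E d → ℝ) : Prop where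
  left : LocallyIntegrableOn u Ω
  right : LocallyIntegrableOn v Ω
  integral_eq : ∀ φ : E d → ℝ, IsTestFunction Ω φ →
    ∫ x in Ω, u x * multiDeriv α φ x = (-1) ^ (∑ i, α i) * ∫ x in Ω, v x * φ x

/-- `u ∈ W_p^k(Ω)`: all weak derivatives of order at most `k` exist and lie in `L_p(Ω)`. -/
structure MemSobolev (Ω : Set (E d)) (k : ℕ) (p : ℝ≥0∞) (u : E d → ℝ) : Prop where
  memLp : MemLp u p (volume.restrict Ω)
  deriv : ∀ α : Fin d → ℕ, ∑ i, α i ≤ k →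
    ∃ v : E d → ℝ, HasWeakDeriv Ω α u v ∧ MemLp v p (volume.restrict Ω)

open Classical in
/-- The weak derivative of `u` (unique a.e. in an open `Ω`); zero if there is none. -/
def weakDeriv (Ω : Set (E d)) (α : Fin d → ℕ) (u : E d → ℝ) : E d → ℝ :=
  if h : ∃ v, HasWeakDeriv Ω α u v then h.choose else 0

/-- The Laplacian `Δu = ∑ i, ∂²u/∂x_i²`, in the sense of weak derivatives in `Ω`. -/
def weakLaplacian (Ω : Set (E d)) (u : E d → ℝ) : E d → ℝ :=
  fun x => ∑ i, weakDeriv Ω (Pi.single i 2) u x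

/-! ### Boundary values -/

/-- Surface measure on `∂Ω`: the `(d-1)`-dimensional Hausdorff measure. -/
def surfaceMeasure (Ω : Set (E d)) : Measure (E d) :=
  (Measure.hausdorffMeasure ((d : ℝ) - 1)).restrict (frontier Ω)

/-- `u = g` on `∂Ω` in the sense of traces: at almost every boundary point `x`, the mean of
`|u - g(x)|` over `Ω ∩ B(x, r)` tends to `0` as `r → 0`. If `u` is continuous up to the boundary,
this says that `u = g` almost everywhere on `∂Ω`. -/
def HasTrace (Ω : Set (E d)) (u g : E d → ℝ) : Prop :=
  ∀ᵐ x ∂(surfaceMeasure Ω),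
    Tendsto (fun r : ℝ => ⨍⁻ y in Ω ∩ Metric.ball x r, ‖u y - g x‖ₑ ∂volume) (𝓝[>] 0) (𝓝 0)

open Classical in
/-- The boundary values of `u` (unique a.e. on `∂Ω`); zero if there are none. -/
def boundaryTrace (Ω : Set (E d)) (u : E d → ℝ) : E d → ℝ :=
  if h : ∃ g, HasTrace Ω u g then h.choose else 0

/-! ### The Poisson problem -/

/-- `-Δu = f` in `Ω`, `u = g` on `∂Ω`. -/
structure IsPoissonSolution (Ω : Set (E d)) (f g u : E d → ℝ) : Prop where
  interior : ∀ᵐ x ∂(volume.restrict Ω), -weakLaplacian Ω u x = f x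
  boundary : HasTrace Ω u g

/-- The data norm `‖u‖_F = max (‖Δu‖_{L_∞(Ω)}) (‖u‖_{L_∞(∂Ω)})`. -/
def dataNorm (Ω : Set (E d)) (u : E d → ℝ) : ℝ≥0∞ :=
  max (eLpNorm (weakLaplacian Ω u) ∞ (volume.restrict Ω))
    (eLpNorm (boundaryTrace Ω u) ∞ (surfaceMeasure Ω))

end PoissonEstimate

end

noncomputable section

namespace PoissonEstimate

variable {d : ℕ}

/-! ### The maximum principle -/

/-! The core is the maximum principle by comparison with a quadratic. If |Δu| ≤ N in Ω and |u| ≤ N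
on ∂Ω, then u + (N + η)|y - x|² is strictly subharmonic, so it cannot peak inside; hence |u| ≤ N(1 +
diam² Ω) almost everywhere. A factor |Ω|^{1/2}, at most the root of the volume of a ball of radius
diam Ω, turns this into the L_2 bound with a constant that only sees d and the diameter.

The work lies in the low regularity. Inside, mollification gives smooth functions close to u on
compact sets whose Laplacians obey the same bound (`MemSobolev.exists_smooth_approx`), and
`le_of_smooth_approx_of_boundary_le` asks for no more than that. At the boundary the trace is
controlled only almost everywhere. The bounded gradient makes u Lipschitz along segments in Ω, hence
Lipschitz near each boundary point (`SegmentLipschitz.lipschitz_near_boundary`). Boundary patches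
have positive surface measure (`surfaceMeasure_ball_pos`), so good points accumulate at every
boundary point and the bound spreads to all of ∂Ω. -/

/-- If c were positive, t would also be a local minimum, so h would be constant near t and c would
vanish. -/
theorem second_deriv_nonpos_of_isLocalMax {h h' : ℝ → ℝ} {c t : ℝ} (hmax : IsLocalMax h t)
    (h1 : ∀ s, HasDerivAt h (h' s) s) (h2 : HasDerivAt h' c t) : c ≤ 0 := by
  by_contra! hc
  have e1 : deriv h = h' := funext fun s => (h1 s).deriv
  have hmin : IsLocalMin h t := by
    apply isLocalMin_of_deriv_deriv_pos
    · rw [e1, h2.deriv]; exact hc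
    · exact hmax.deriv_eq_zero
    · exact (h1 t).continuousAt
  have hconst : h =ᶠ[𝓝 t] fun _ => h t := by
    filter_upwards [hmin, hmax] with s a b using le_antisymm b a
  have hd : deriv h =ᶠ[𝓝 t] fun _ => 0 := by
    simpa using hconst.deriv
  have : c = 0 := by
    rw [← h2.deriv, ← e1, hd.deriv_eq]; simp
  exact hc.ne' this

theorem contDiff_partialDeriv {φ : E d → ℝ} (hφ : ContDiff ℝ ∞ φ) (i : Fin d) :
    ContDiff ℝ ∞ (partialDeriv i φ) :=
  (hφ.fderiv_right (m := ∞) (by simp)).clm_apply contDiff_const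

theorem hasDerivAt_line {φ : E d → ℝ} (hφ : ContDiff ℝ ∞ φ) (i : Fin d) (p : E d) (s : ℝ) :
    HasDerivAt (fun t : ℝ => φ (p + t • EuclideanSpace.single i 1))
      (partialDeriv i φ (p + s • EuclideanSpace.single i 1)) s := by
  have hφd : HasFDerivAt φ (fderiv ℝ φ (p + s • EuclideanSpace.single i 1))
      (p + s • EuclideanSpace.single i 1) :=
    (hφ.differentiable (by simp)).differentiableAt.hasFDerivAt
  refine hφd.comp_hasDerivAt s ?_
  simpa using ((hasDerivAt_id s).smul_const (EuclideanSpace.single i (1 : ℝ))).const_add p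

theorem partialDeriv_partialDeriv_le_of_isLocalMax {W : E d → ℝ} (hW : ContDiff ℝ ∞ W) {A : ℝ}
    {x₀ p : E d} (hmax : IsLocalMax (fun y => W y + A * ‖y - x₀‖ ^ 2) p) (i : Fin d) :
    partialDeriv i (partialDeriv i W) p ≤ -(2 * A) := by
  set e : E d := EuclideanSpace.single i 1 with he
  have hnorm : ∀ t : ℝ, ‖p + t • e - x₀‖ ^ 2
      = ‖p - x₀‖ ^ 2 + 2 * t * inner ℝ (p - x₀) e + t ^ 2 := by
    intro t
    rw [show p + t • e - x₀ = (p - x₀) + t • e by abel, norm_add_sq_real, inner_smul_right,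
      norm_smul]
    have he1 : ‖e‖ = 1 := by simp [he]
    rw [he1, Real.norm_eq_abs, mul_one, sq_abs]
    ring
  have hcont : Tendsto (fun t : ℝ => p + t • e) (𝓝 0) (𝓝 p) := by
    have : Continuous fun t : ℝ => p + t • e := by fun_prop
    simpa using this.tendsto 0
  have hm : IsLocalMax (fun t : ℝ => W (p + t • e) + A * ‖p + t • e - x₀‖ ^ 2) 0 := by
    have := hcont.eventually hmax
    simpa [IsLocalMax, IsMaxFilter] using this
  have h1 : ∀ s : ℝ, HasDerivAt (fun t : ℝ => W (p + t • e) + A * ‖p + t • e - x₀‖ ^ 2)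
      (partialDeriv i W (p + s • e) + A * (2 * inner ℝ (p - x₀) e + 2 * s)) s := by
    intro s
    refine (hasDerivAt_line hW i p s).add (HasDerivAt.const_mul A ?_)
    simp only [hnorm]
    have := (((hasDerivAt_id s).const_mul 2).mul_const (inner ℝ (p - x₀) e)).const_add
      (‖p - x₀‖ ^ 2) |>.add (hasDerivAt_pow 2 s)
    exact this.congr_deriv (by simp)
  have h2 : HasDerivAt
      (fun s : ℝ => partialDeriv i W (p + s • e) + A * (2 * inner ℝ (p - x₀) e + 2 * s))
      (partialDeriv i (partialDeriv i W) p + A * 2) 0 := by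
    have a := hasDerivAt_line (contDiff_partialDeriv hW i) i p 0
    rw [← he] at a
    simp only [zero_smul, add_zero] at a
    refine a.add (HasDerivAt.const_mul A ?_)
    simpa using ((hasDerivAt_id (0 : ℝ)).const_mul 2).const_add (2 * inner ℝ (p - x₀) e)
  have := second_deriv_nonpos_of_isLocalMax hm h1 h2
  linarith

/-- Maximum principle for locally uniform limits of smooth functions whose Laplacians are
bounded below. -/
theorem le_of_smooth_approx_of_boundary_le (hd : 1 ≤ d) {Ω : Set (E d)} (hΩ : IsOpen Ω)
    (hb : Bornology.IsBounded Ω) {V : E d → ℝ} (hV : ContinuousOn V Ω) {F G : ℝ} (hF : 0 ≤ F)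
    (happ : ∀ K ⊆ Ω, IsCompact K → ∀ η > 0, ∃ W : E d → ℝ, ContDiff ℝ ∞ W ∧
      ∀ y ∈ K, |W y - V y| ≤ η ∧ -F ≤ ∑ i, partialDeriv i (partialDeriv i W) y)
    (hbd : ∀ x ∈ frontier Ω, ∀ η > 0, ∀ᶠ y in 𝓝 x, y ∈ Ω → V y ≤ G + η)
    {x : E d} (hx : x ∈ Ω) : V x ≤ G + F * Metric.diam Ω ^ 2 := by
  set D := Metric.diam Ω with hD
  have hmain : ∀ η > 0, V x ≤ G + 3 * η + (F + η) * D ^ 2 := by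
    intro η hη
    by_cases hxG : V x ≤ G + η
    · nlinarith [sq_nonneg D]
    push Not at hxG
    -- This superlevel set is compact: near ∂Ω the values of V stay below G + η, so it cannot
    -- accumulate there.
    set K : Set (E d) := {y | y ∈ Ω ∧ G + η ≤ V y} with hK
    have hKΩ : K ⊆ Ω := fun y hy => hy.1
    have hKclosed : IsClosed K := by
      rw [← closure_subset_iff_isClosed]
      intro y hy
      have hyc : y ∈ closure Ω := closure_mono hKΩ hy
      by_cases hyΩ : y ∈ Ω
      · refine ⟨hyΩ, ?_⟩
        have hca : ContinuousAt V y := hV.continuousAt (hΩ.mem_nhds hyΩ)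
        rw [mem_closure_iff_frequently] at hy
        exact ge_of_tendsto_of_frequently hca (hy.mono fun z hz => hz.2)
      · exfalso
        have hyf : y ∈ frontier Ω := by
          rw [hΩ.frontier_eq]; exact ⟨hyc, hyΩ⟩
        rw [mem_closure_iff_frequently] at hy
        obtain ⟨z, hz, hz'⟩ := (hy.and_eventually (hbd y hyf (η / 2) (by positivity))).exists
        linarith [hz.2, hz' hz.1]
    have hKcompact : IsCompact K := Metric.isCompact_of_isClosed_isBounded hKclosed (hb.subset hKΩ)
    obtain ⟨δ, hδ, hδΩ⟩ := hKcompact.exists_cthickening_subset_open hΩ hKΩ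
    set K' := Metric.cthickening δ K
    have hK'c : IsCompact K' := hKcompact.cthickening
    have hxK : x ∈ K := ⟨hx, hxG.le⟩
    have hKK' : K ⊆ K' := Metric.self_subset_cthickening K
    obtain ⟨W, hW, hWK⟩ := happ K' hδΩ hK'c η hη
    set w : E d → ℝ := fun y => W y + (F + η) * ‖y - x‖ ^ 2 with hw
    have hwc : Continuous w := by
      have := hW.continuous
      fun_prop
    -- A maximum of w over the thickening at a point of K would be an interior one, forcing ΔW ≤
    -- -2d(F + η) < -F. So p lies off K, where V ≤ G + η.
    obtain ⟨p, hpK', hpmax⟩ := hK'c.exists_isMaxOn ⟨x, hKK' hxK⟩ hwc.continuousOn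
    have hpK : p ∉ K := by
      intro hpK
      have hloc : IsLocalMax w p := by
        apply hpmax.isLocalMax
        exact mem_of_superset (Metric.isOpen_thickening.mem_nhds
          (Metric.self_subset_thickening hδ K hpK)) (Metric.thickening_subset_cthickening δ K)
      have hi := fun i => partialDeriv_partialDeriv_le_of_isLocalMax hW hloc i
      have hsum : ∑ i, partialDeriv i (partialDeriv i W) p ≤ ∑ _i : Fin d, -(2 * (F + η)) :=
        Finset.sum_le_sum fun i _ => hi i
      have h2 := (hWK p hpK').2
      simp only [Finset.sum_const, Finset.card_univ, Fintype.card_fin, nsmul_eq_mul] at hsum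
      have hd' : (1 : ℝ) ≤ d := by exact_mod_cast hd
      nlinarith
    have hpV : V p ≤ G + η := by
      by_contra! h
      exact hpK ⟨hδΩ hpK', h.le⟩
    have hxp : w x ≤ w p := hpmax (hKK' hxK)
    have hdist : ‖p - x‖ ≤ D := by
      rw [← dist_eq_norm]
      exact Metric.dist_le_diam_of_mem hb (hδΩ hpK') hx
    have hsq : ‖p - x‖ ^ 2 ≤ D ^ 2 := by gcongr
    have a1 := abs_le.1 (hWK p hpK').1
    have a2 := abs_le.1 (hWK x (hKK' hxK)).1
    simp only [hw, sub_self, norm_zero] at hxp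
    have : (F + η) * ‖p - x‖ ^ 2 ≤ (F + η) * D ^ 2 := by gcongr
    -- The 3η collects the error of W at x, the error of W at p, and the slack in V p ≤ G + η.
    nlinarith
  have hlim : Tendsto (fun η : ℝ => G + 3 * η + (F + η) * D ^ 2) (𝓝[>] 0)
      (𝓝 (G + F * D ^ 2)) := by
    have : Continuous fun η : ℝ => G + 3 * η + (F + η) * D ^ 2 := by fun_prop
    simpa using (this.tendsto 0).mono_left nhdsWithin_le_nhds
  exact ge_of_tendsto hlim (by filter_upwards [self_mem_nhdsWithin] with η hη using hmain η hη)

/-! ### Geometry near the boundary -/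

/-- `U` is Lipschitz with constant `L` along the segments contained in `Ω`. -/
def SegmentLipschitz (Ω : Set (E d)) (L : ℝ) (U : E d → ℝ) : Prop :=
  ∀ x y, segment ℝ x y ⊆ Ω → |U x - U y| ≤ L * ‖x - y‖

theorem sub_inner_smul_add_smul {e : E d} (he : ‖e‖ = 1) (y : E d) (s : ℝ) :
    (y + s • e) - inner ℝ e (y + s • e) • e = y - inner ℝ e y • e := by
  rw [inner_add_right, inner_smul_right, real_inner_self_eq_norm_sq, he]
  module

theorem norm_sub_inner_smul_le {e : E d} (he : ‖e‖ = 1) (y : E d) :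
    ‖y - inner ℝ e y • e‖ ≤ ‖y‖ := by
  have h : ‖y - inner ℝ e y • e‖ ^ 2 = ‖y‖ ^ 2 - (inner ℝ e y) ^ 2 := by
    rw [norm_sub_sq_real, inner_smul_right, norm_smul, he, real_inner_comm y e, mul_one,
      Real.norm_eq_abs, sq_abs]
    ring
  exact le_of_sq_le_sq (by nlinarith [sq_nonneg (inner ℝ e y)]) (norm_nonneg y)

/-- The segment from y to z may leave Ω, so both ends are lifted by s = (K + 1)‖y - z‖ along e.
Along the lifted segment γ rises by at most K‖y - z‖ and the height drops by at most ‖y - z‖, so it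
stays above the graph. The three-segment path has length (2K + 3)‖y - z‖. -/
theorem SegmentLipschitz.lipschitz_near_boundary {Ω : Set (E d)} {L : ℝ} {U : E d → ℝ}
    (hL : 0 ≤ L) (hU : SegmentLipschitz Ω L U) (hlip : HasLipschitzBoundary Ω) {x₀ : E d}
    (hx₀ : x₀ ∈ frontier Ω) :
    ∃ ρ > 0, ∃ C ≥ 0, ∀ y ∈ Ω ∩ Metric.ball x₀ ρ, ∀ z ∈ Ω ∩ Metric.ball x₀ ρ,
      |U y - U z| ≤ C * ‖y - z‖ := by
  obtain ⟨r, hr, e, he, K, γ, hγ, hΩ⟩ := hlip x₀ hx₀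
  have hmem : ∀ y ∈ Metric.ball x₀ r, (y ∈ Ω ↔ γ (y - inner ℝ e y • e) < inner ℝ e y) := by
    intro y hy
    have := Set.ext_iff.1 hΩ y
    simpa [hy] using this
  have hK : (0 : ℝ) ≤ K := K.2
  -- With ρ this radius, a lifted point is within ρ + (K + 1)·2ρ = r of x₀.
  have hρ : 0 < r / (2 * K + 3) := by positivity
  have hρr : r / (2 * K + 3) ≤ r := div_le_self hr.le (by linarith)
  -- points above points of `Ω` are in `Ω`
  have hup : ∀ y ∈ Ω ∩ Metric.ball x₀ r, ∀ s : ℝ, 0 ≤ s → y + s • e ∈ Metric.ball x₀ r →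
      segment ℝ y (y + s • e) ⊆ Ω := by
    intro y hy s hs hys q hq
    have hqb : q ∈ Metric.ball x₀ r := (convex_ball x₀ r).segment_subset hy.2 hys hq
    rw [segment_eq_image'] at hq
    obtain ⟨t, ht, rfl⟩ := hq
    have e1 : y + t • (y + s • e - y) = y + (t * s) • e := by module
    simp only [e1] at hqb ⊢
    rw [hmem _ hqb, sub_inner_smul_add_smul he, inner_add_right, inner_smul_right,
      real_inner_self_eq_norm_sq, he]
    have := (hmem y hy.2).1 hy.1
    nlinarith [mul_nonneg ht.1 hs]
  refine ⟨r / (2 * K + 3), hρ, L * (2 * K + 3), by positivity, ?_⟩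
  rintro y ⟨hyΩ, hy⟩ z ⟨hzΩ, hz⟩
  have hyr := Metric.ball_subset_ball hρr hy
  have hzr := Metric.ball_subset_ball hρr hz
  set s : ℝ := (K + 1) * ‖y - z‖ with hs
  have hs0 : 0 ≤ s := by positivity
  have hyz : ‖y - z‖ < 2 * (r / (2 * K + 3)) := by
    rw [← dist_eq_norm]
    have := dist_triangle_right y z x₀
    rw [Metric.mem_ball] at hy hz
    linarith
  have hshift : ∀ q ∈ Metric.ball x₀ (r / (2 * K + 3)), q + s • e ∈ Metric.ball x₀ r := by
    intro q hq
    rw [mem_ball_iff_norm] at hq ⊢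
    have h1 : ‖q + s • e - x₀‖ ≤ ‖q - x₀‖ + s := by
      rw [show q + s • e - x₀ = (q - x₀) + s • e by abel]
      refine (norm_add_le _ _).trans_eq ?_
      rw [norm_smul, he, mul_one, Real.norm_of_nonneg hs0]
    have h2 : s ≤ (K + 1) * (2 * (r / (2 * K + 3))) := by rw [hs]; gcongr
    have h3 : (2 * K + 3) * (r / (2 * K + 3)) = r := by field_simp
    nlinarith
  have hp := hshift y hy
  have hq := hshift z hz
  have hseg : segment ℝ (y + s • e) (z + s • e) ⊆ Ω := by
    intro q hqs
    have hqb : q ∈ Metric.ball x₀ r := (convex_ball x₀ r).segment_subset hp hq hqs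
    rw [segment_eq_image'] at hqs
    obtain ⟨t, ht, rfl⟩ := hqs
    have e1 : y + s • e + t • (z + s • e - (y + s • e)) = (y + t • (z - y)) + s • e := by module
    simp only [e1] at hqb ⊢
    rw [hmem _ hqb, sub_inner_smul_add_smul he, inner_add_right e _ (s • e),
      inner_smul_right e e, real_inner_self_eq_norm_sq, he]
    have h0 := (hmem y hyr).1 hyΩ
    have h1 : γ (y + t • (z - y) - inner ℝ e (y + t • (z - y)) • e) -
        γ (y - inner ℝ e y • e) ≤ K * ‖y - z‖ := by
      refine (le_abs_self _).trans ?_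
      rw [← Real.dist_eq]
      refine (hγ.dist_le_mul _ _).trans ?_
      gcongr
      rw [dist_eq_norm]
      have e2 : y + t • (z - y) - inner ℝ e (y + t • (z - y)) • e - (y - inner ℝ e y • e)
          = t • (z - y) - inner ℝ e (t • (z - y)) • e := by
        rw [inner_add_right]; module
      rw [e2]
      refine (norm_sub_inner_smul_le he _).trans ?_
      rw [norm_smul, Real.norm_of_nonneg ht.1, norm_sub_rev z y]
      exact mul_le_of_le_one_left (norm_nonneg _) ht.2
    have h2 : -‖y - z‖ ≤ t * inner ℝ e (z - y) := by
      have h3 : |inner ℝ e (z - y)| ≤ ‖y - z‖ := by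
        have := abs_real_inner_le_norm e (z - y)
        rwa [he, one_mul, norm_sub_rev] at this
      have h4 := (abs_le.1 h3).1
      nlinarith [ht.1, ht.2, norm_nonneg (y - z)]
    have h5 : inner ℝ e (y + t • (z - y)) = inner ℝ e y + t * inner ℝ e (z - y) := by
      rw [inner_add_right, inner_smul_right]
    nlinarith
  have b1 := hU _ _ (hup y ⟨hyΩ, hyr⟩ s hs0 hp)
  have b2 := hU _ _ hseg
  have b3 := hU _ _ (hup z ⟨hzΩ, hzr⟩ s hs0 hq)
  have n1 : ∀ q : E d, ‖q - (q + s • e)‖ = s := by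
    intro q
    rw [sub_add_cancel_left, norm_neg, norm_smul, he, mul_one, Real.norm_of_nonneg hs0]
  rw [n1] at b1 b3
  rw [add_sub_add_right_eq_sub] at b2
  have : L * (2 * K + 3) * ‖y - z‖ = L * s + L * ‖y - z‖ + L * s := by rw [hs]; ring
  rw [this]
  rw [abs_le] at b1 b2 b3 ⊢
  constructor <;> linarith [b1.1, b1.2, b2.1, b2.2, b3.1, b3.2]

/-- Projecting the boundary graph onto the hyperplane orthogonal to e does not increase Hausdorff
measure, and the image of a patch contains a nonempty open set. -/
theorem surfaceMeasure_ball_pos (hd : 1 ≤ d) {Ω : Set (E d)} (hΩo : IsOpen Ω)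
    (hlip : HasLipschitzBoundary Ω) {x₀ : E d} (hx₀ : x₀ ∈ frontier Ω) {ρ : ℝ} (hρ : 0 < ρ) :
    0 < surfaceMeasure Ω (Metric.ball x₀ ρ) := by
  obtain ⟨r, hr, e, he, K, γ, hγ, hΩ⟩ := hlip x₀ hx₀
  have hmem : ∀ y ∈ Metric.ball x₀ r, (y ∈ Ω ↔ γ (y - inner ℝ e y • e) < inner ℝ e y) := by
    intro y hy
    have := Set.ext_iff.1 hΩ y
    simpa [hy] using this
  have hγc : Continuous γ := hγ.continuous
  obtain ⟨n, rfl⟩ : ∃ n, d = n + 1 := ⟨d - 1, by omega⟩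
  have hfr : Fact (Module.finrank ℝ (E (n + 1)) = n + 1) := ⟨by simp⟩
  have he0 : e ≠ 0 := by rintro rfl; simp at he
  set b := OrthonormalBasis.fromOrthogonalSpanSingleton (𝕜 := ℝ) n he0 with hb
  have hperp : ∀ q : (ℝ ∙ e)ᗮ, inner ℝ e (q : E (n + 1)) = 0 := fun q =>
    Submodule.mem_orthogonal_singleton_iff_inner_right.1 q.2
  -- parametrization of the graph, and its left inverse
  set P : (Fin n → ℝ) → (ℝ ∙ e)ᗮ := fun c => ∑ i, c i • b i with hP
  set Γ : (Fin n → ℝ) → E (n + 1) := fun c => (P c : E (n + 1)) + γ (P c) • e with hΓ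
  set f : E (n + 1) → (Fin n → ℝ) := fun y i => inner ℝ (b i : E (n + 1)) y with hf
  have hPc : Continuous P := by fun_prop
  have hΓc : Continuous Γ := by fun_prop
  -- The target carries the sup metric, for which n-dimensional Hausdorff measure is exactly
  -- Lebesgue measure.
  have hflip : LipschitzWith 1 f := by
    refine LipschitzWith.of_dist_le_mul fun y z => ?_
    rw [NNReal.coe_one, one_mul, dist_pi_le_iff dist_nonneg]
    intro i
    rw [Real.dist_eq, dist_eq_norm]
    simp only [hf]
    rw [← inner_sub_right]
    refine (abs_real_inner_le_norm _ _).trans ?_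
    have : ‖(b i : E (n + 1))‖ = 1 := b.norm_eq_one i
    rw [this, one_mul]
  have hfΓ : ∀ c, f (Γ c) = c := by
    intro c
    ext i
    simp only [hf, hΓ]
    rw [inner_add_right, inner_smul_right, real_inner_comm e, hperp, mul_zero, add_zero,
      ← Submodule.coe_inner]
    simp only [hP]
    rw [← b.repr_apply_apply]
    simp [map_sum, Pi.single_apply]
  have hinner : ∀ c, inner ℝ e (Γ c) = γ (P c) := by
    intro c
    simp only [hΓ]
    rw [inner_add_right, hperp, inner_smul_right, real_inner_self_eq_norm_sq, he]
    ring
  have hproj : ∀ c, Γ c - inner ℝ e (Γ c) • e = P c := by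
    intro c
    rw [hinner]; simp [hΓ]
  have hfrontier : ∀ c, Γ c ∈ Metric.ball x₀ r → Γ c ∈ frontier Ω := by
    intro c hc
    rw [hΩo.frontier_eq]
    constructor
    · have hlim : Tendsto (fun t : ℝ => Γ c + t • e) (𝓝[>] 0) (𝓝 (Γ c)) := by
        have : Continuous fun t : ℝ => Γ c + t • e := by fun_prop
        simpa using (this.tendsto 0).mono_left nhdsWithin_le_nhds
      refine mem_closure_of_tendsto hlim ?_
      filter_upwards [self_mem_nhdsWithin, hlim.eventually (Metric.isOpen_ball.mem_nhds hc)]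
        with t ht htb
      rw [hmem _ htb, sub_inner_smul_add_smul he, hproj, inner_add_right, hinner,
        inner_smul_right, real_inner_self_eq_norm_sq, he]
      simpa using ht
    · rw [hmem _ hc, hproj, hinner]
      exact lt_irrefl _
  -- `x₀` is on the graph
  have hx₀' := hx₀
  rw [hΩo.frontier_eq] at hx₀'
  have hgraph : γ (x₀ - inner ℝ e x₀ • e) = inner ℝ e x₀ := by
    apply le_antisymm
    · have hfreq := mem_closure_iff_frequently.1 hx₀'.1
      have hc : ContinuousAt (fun y : E (n + 1) => inner ℝ e y - γ (y - inner ℝ e y • e)) x₀ := by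
        fun_prop
      have : 0 ≤ inner ℝ e x₀ - γ (x₀ - inner ℝ e x₀ • e) := by
        refine ge_of_tendsto_of_frequently hc ?_
        refine (hfreq.and_eventually (Metric.ball_mem_nhds x₀ hr)).mono fun y hy => ?_
        have := (hmem y hy.2).1 hy.1
        linarith
      linarith
    · by_contra! h
      exact hx₀'.2 ((hmem x₀ (Metric.mem_ball_self hr)).2 h)
  have hperp₀ : x₀ - inner ℝ e x₀ • e ∈ (ℝ ∙ e)ᗮ := by
    rw [Submodule.mem_orthogonal_singleton_iff_inner_right, inner_sub_right, inner_smul_right,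
      real_inner_self_eq_norm_sq, he]
    ring
  set c₀ : Fin n → ℝ := fun i => b.repr ⟨_, hperp₀⟩ i with hc₀
  have hΓc₀ : Γ c₀ = x₀ := by
    have : P c₀ = ⟨_, hperp₀⟩ := b.sum_repr ⟨_, hperp₀⟩
    simp only [hΓ, this, hgraph]
    abel
  set O : Set (Fin n → ℝ) := Γ ⁻¹' (Metric.ball x₀ (min r ρ)) with hO
  have hOo : IsOpen O := Metric.isOpen_ball.preimage hΓc
  have hOne : O.Nonempty := ⟨c₀, by
    rw [hO, mem_preimage, hΓc₀]; exact Metric.mem_ball_self (lt_min hr hρ)⟩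
  have hsub : O ⊆ f '' (Metric.ball x₀ ρ ∩ frontier Ω) := by
    intro c hc
    refine ⟨Γ c, ⟨Metric.ball_subset_ball (min_le_right _ _) hc,
      hfrontier c (Metric.ball_subset_ball (min_le_left _ _) hc)⟩, hfΓ c⟩
  have hvol : 0 < volume O := hOo.measure_pos volume hOne
  rw [surfaceMeasure, Measure.restrict_apply Metric.isOpen_ball.measurableSet]
  have hdim : (((n + 1 : ℕ) : ℝ) - 1) = (Fintype.card (Fin n) : ℝ) := by simp
  rw [hdim]
  calc 0 < volume O := hvol
    _ = Measure.hausdorffMeasure (Fintype.card (Fin n) : ℝ) O := by rw [hausdorffMeasure_pi_real]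
    _ ≤ Measure.hausdorffMeasure (Fintype.card (Fin n) : ℝ)
        (f '' (Metric.ball x₀ ρ ∩ frontier Ω)) := measure_mono hsub
    _ ≤ _ := by
      refine (hflip.hausdorffMeasure_image_le (by positivity) _).trans ?_
      simp

/-! ### Mollification -/

/-- The mollification on `Ω` of `u` by the kernel `ψ`. -/
def mollify (Ω : Set (E d)) (ψ u : E d → ℝ) (x : E d) : ℝ :=
  ∫ y in Ω, u y * ψ (x - y)

theorem mollify_eq_convolution {Ω : Set (E d)} (hΩ : MeasurableSet Ω) (ψ u : E d → ℝ) :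
    mollify Ω ψ u = convolution (Ω.indicator u) ψ (ContinuousLinearMap.lsmul ℝ ℝ) volume := by
  ext x
  rw [mollify, convolution_def, ← integral_indicator hΩ]
  congr 1
  ext y
  by_cases hy : y ∈ Ω <;> simp [hy]

/-- Differentiation uses the kernel as right factor; the convergence results for bump functions use
it as left factor. -/
theorem mollify_eq_convolution_swap {Ω : Set (E d)} (hΩ : MeasurableSet Ω) (ψ u : E d → ℝ)
    (x : E d) :
    mollify Ω ψ u x
      = convolution ψ (Ω.indicator u) (ContinuousLinearMap.lsmul ℝ ℝ) volume x := by
  rw [mollify_eq_convolution hΩ, convolution_lsmul_swap, convolution_def]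
  simp [mul_comm]

theorem contDiff_mollify {Ω : Set (E d)} (hΩ : MeasurableSet Ω) {ψ u : E d → ℝ}
    (hu : IntegrableOn u Ω) (hψ : ContDiff ℝ ∞ ψ) (hψc : HasCompactSupport ψ) :
    ContDiff ℝ ∞ (mollify Ω ψ u) := by
  rw [mollify_eq_convolution hΩ]
  exact hψc.contDiff_convolution_right _ ((integrable_indicator_iff hΩ).2 hu).locallyIntegrable hψ

theorem hasCompactSupport_partialDeriv {ψ : E d → ℝ} (hψc : HasCompactSupport ψ) (i : Fin d) :
    HasCompactSupport (partialDeriv i ψ) :=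
  hψc.fderiv_apply ℝ _

theorem partialDeriv_mollify {Ω : Set (E d)} (hΩ : MeasurableSet Ω) {ψ u : E d → ℝ}
    (hu : IntegrableOn u Ω) (hψ : ContDiff ℝ ∞ ψ) (hψc : HasCompactSupport ψ) (i : Fin d) :
    partialDeriv i (mollify Ω ψ u) = mollify Ω (partialDeriv i ψ) u := by
  ext x
  have hg := ((integrable_indicator_iff hΩ).2 hu).locallyIntegrable
  have hψ1 : ContDiff ℝ 1 ψ := hψ.of_le (by simp)
  rw [mollify_eq_convolution hΩ, mollify_eq_convolution hΩ, partialDeriv,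
    (hψc.hasFDerivAt_convolution_right (ContinuousLinearMap.lsmul ℝ ℝ) hg hψ1 x).fderiv,
    convolution_precompR_apply _ hg (hψc.fderiv ℝ) (hψ1.continuous_fderiv (by simp))]
  rfl

theorem iterate_partialDeriv_mollify {Ω : Set (E d)} (hΩ : MeasurableSet Ω) {u : E d → ℝ}
    (hu : IntegrableOn u Ω) (i : Fin d) (k : ℕ) {ψ : E d → ℝ} (hψ : ContDiff ℝ ∞ ψ)
    (hψc : HasCompactSupport ψ) :
    (partialDeriv i)^[k] (mollify Ω ψ u) = mollify Ω ((partialDeriv i)^[k] ψ) u := by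
  induction k generalizing ψ with
  | zero => rfl
  | succ k ih =>
    rw [Function.iterate_succ_apply, partialDeriv_mollify hΩ hu hψ hψc,
      ih (contDiff_partialDeriv hψ i) (hasCompactSupport_partialDeriv hψc i),
      Function.iterate_succ_apply]

theorem partialDeriv_const_mul_comp_sub {ψ : E d → ℝ} (hψ : ContDiff ℝ ∞ ψ) (i : Fin d) (c : ℝ)
    (x : E d) :
    partialDeriv i (fun y => c * ψ (x - y)) = fun y => (-c) * partialDeriv i ψ (x - y) := by
  ext y
  have h1 : HasFDerivAt ψ (fderiv ℝ ψ (x - y)) (x - y) :=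
    (hψ.differentiable (by simp)).differentiableAt.hasFDerivAt
  have h2 := (h1.comp y ((hasFDerivAt_id y).const_sub x)).const_mul c
  have h3 : fderiv ℝ (fun y => c * ψ (x - y)) y = _ := h2.fderiv
  rw [partialDeriv, h3, partialDeriv]
  simp

theorem iterate_partialDeriv_const_mul_comp_sub (i : Fin d) (k : ℕ) {ψ : E d → ℝ}
    (hψ : ContDiff ℝ ∞ ψ) (c : ℝ) (x : E d) :
    (partialDeriv i)^[k] (fun y => c * ψ (x - y))
      = fun y => ((-1) ^ k * c) * (partialDeriv i)^[k] ψ (x - y) := by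
  induction k generalizing ψ c with
  | zero => simp
  | succ k ih =>
    rw [Function.iterate_succ_apply, partialDeriv_const_mul_comp_sub hψ,
      ih (contDiff_partialDeriv hψ i), Function.iterate_succ_apply]
    ext y
    ring

theorem multiDeriv_single (i : Fin d) (k : ℕ) (φ : E d → ℝ) :
    multiDeriv (Pi.single i k) φ = (partialDeriv i)^[k] φ := by
  have h : ∀ l : List (Fin d), l.Nodup →
      l.foldr (fun j ψ => (partialDeriv j)^[(Pi.single i k : Fin d → ℕ) j] ψ) φ
        = if i ∈ l then (partialDeriv i)^[k] φ else φ := by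
    intro l
    induction l with
    | nil => simp
    | cons a l ih =>
      intro hl
      rw [List.nodup_cons] at hl
      rw [List.foldr_cons, ih hl.2]
      by_cases hia : i = a
      · subst hia
        simp [hl.1]
      · have hai : a ≠ i := fun h => hia h.symm
        simp [hia, hai]
  rw [multiDeriv, h _ (List.nodup_finRange d)]
  simp

/-- Differentiating a mollification mollifies the weak derivative. -/
theorem HasWeakDeriv.iterate_partialDeriv_mollify {Ω : Set (E d)} (hΩ : MeasurableSet Ω)
    {u v ψ : E d → ℝ} (hu : IntegrableOn u Ω) {i : Fin d} {k : ℕ}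
    (h : HasWeakDeriv Ω (Pi.single i k) u v) (hψ : ContDiff ℝ ∞ ψ) {ε : ℝ}
    (hψs : tsupport ψ ⊆ Metric.closedBall 0 ε) {x : E d} (hx : Metric.closedBall x ε ⊆ Ω) :
    (partialDeriv i)^[k] (mollify Ω ψ u) x = mollify Ω ψ v x := by
  have hψc : HasCompactSupport ψ :=
    (isCompact_closedBall (0 : E d) ε).of_isClosed_subset (isClosed_tsupport ψ) hψs
  have hsupp : tsupport (fun y => ψ (x - y)) ⊆ Metric.closedBall x ε := by
    refine closure_minimal (fun y hy => ?_) Metric.isClosed_closedBall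
    have := hψs (subset_tsupport ψ hy)
    rwa [mem_closedBall_zero_iff, ← dist_eq_norm, dist_comm] at this
  have htest : IsTestFunction Ω (fun y => ψ (x - y)) :=
    ⟨hψ.comp (contDiff_const.sub contDiff_id),
      (isCompact_closedBall x ε).of_isClosed_subset (isClosed_tsupport _) hsupp,
      hsupp.trans hx⟩
  -- The reflected translate of ψ is the test function; the sign (-1)^k from the reflection cancels
  -- the one in the weak derivative.
  have h1 := h.integral_eq _ htest
  have h2 := iterate_partialDeriv_const_mul_comp_sub i k hψ 1 x
  simp only [one_mul, mul_one] at h2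
  have hs : ∑ j, (Pi.single i k : Fin d → ℕ) j = k := by simp
  rw [multiDeriv_single, h2, hs] at h1
  rw [PoissonEstimate.iterate_partialDeriv_mollify hΩ hu i k hψ hψc, mollify, mollify]
  have h3 : ∫ y in Ω, u y * ((-1) ^ k * (partialDeriv i)^[k] ψ (x - y))
      = (-1) ^ k * ∫ y in Ω, u y * (partialDeriv i)^[k] ψ (x - y) := by
    rw [← integral_const_mul]
    congr 1
    ext y
    ring
  rw [h3] at h1
  exact mul_left_cancel₀ (pow_ne_zero k (by norm_num)) h1

/-- A weak derivative is only known to be locally integrable on Ω; the support of the kernel makes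
the product integrable. -/
theorem integrableOn_mul_comp_sub {Ω : Set (E d)} {v ψ : E d → ℝ} (hv : LocallyIntegrableOn v Ω)
    (hψ : Continuous ψ) {ε : ℝ} (hψs : tsupport ψ ⊆ Metric.closedBall 0 ε) {x : E d}
    (hx : Metric.closedBall x ε ⊆ Ω) : IntegrableOn (fun y => v y * ψ (x - y)) Ω := by
  have h1 : IntegrableOn v (Metric.closedBall x ε) :=
    hv.integrableOn_compact_subset hx (isCompact_closedBall x ε)
  have h2 : IntegrableOn (fun y => v y * ψ (x - y)) (Metric.closedBall x ε) :=
    h1.mul_continuousOn (by fun_prop) (isCompact_closedBall x ε)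
  refine Integrable.integrableOn ((integrableOn_iff_integrable_of_support_subset ?_).1 h2)
  intro y hy
  have hy' : ψ (x - y) ≠ 0 := right_ne_zero_of_mul hy
  have := hψs (subset_tsupport ψ hy')
  rwa [mem_closedBall_zero_iff, ← dist_eq_norm, dist_comm] at this

/-- The standard mollifier of radius `ε`. -/
def mollifier (d : ℕ) (ε : ℝ) (hε : 0 < ε) : ContDiffBump (0 : E d) :=
  ⟨ε / 2, ε, half_pos hε, half_lt_self hε⟩

/-- The kernel is nonnegative with total mass 1, and restricting it to Ω only loses mass. Hence x
may be arbitrary, even near or outside ∂Ω. -/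
theorem abs_mollify_le {Ω : Set (E d)} {v : E d → ℝ} {B : ℝ} (hB : 0 ≤ B)
    (hv : ∀ᵐ y ∂(volume.restrict Ω), |v y| ≤ B) (φ : ContDiffBump (0 : E d)) (x : E d) :
    |mollify Ω (φ.normed volume) v x| ≤ B := by
  have hint : Integrable (fun y => B * φ.normed volume (x - y)) :=
    (φ.integrable_normed.comp_sub_left x).const_mul B
  rw [mollify, ← Real.norm_eq_abs]
  calc ‖∫ y in Ω, v y * φ.normed volume (x - y)‖
      ≤ ∫ y in Ω, B * φ.normed volume (x - y) := by
        refine norm_integral_le_of_norm_le hint.integrableOn ?_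
        filter_upwards [hv] with y hy
        rw [norm_mul, Real.norm_eq_abs, Real.norm_of_nonneg (φ.nonneg_normed _)]
        exact mul_le_mul_of_nonneg_right hy (φ.nonneg_normed _)
    _ ≤ ∫ y, B * φ.normed volume (x - y) :=
        setIntegral_le_integral hint
          (Eventually.of_forall fun y => mul_nonneg hB (φ.nonneg_normed _))
    _ = B := by
        rw [integral_const_mul, integral_sub_left_eq_self (φ.normed volume) volume x,
          φ.integral_normed, mul_one]

/-! ### Lipschitz representative and smooth approximation -/

theorem norm_fderiv_le_sum {W : E d → ℝ} {x : E d} {B : Fin d → ℝ}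
    (hB : ∀ i, |partialDeriv i W x| ≤ B i) : ‖fderiv ℝ W x‖ ≤ ∑ i, B i := by
  have hB0 : ∀ i, 0 ≤ B i := fun i => (abs_nonneg _).trans (hB i)
  refine ContinuousLinearMap.opNorm_le_bound _ (Finset.sum_nonneg fun i _ => hB0 i) fun v => ?_
  have hv : v = ∑ i, v i • (EuclideanSpace.single i (1 : ℝ) : E d) := by
    simpa using ((EuclideanSpace.basisFun (Fin d) ℝ).sum_repr v).symm
  have : fderiv ℝ W x v = ∑ i, v i * partialDeriv i W x := by
    conv_lhs => rw [hv]
    simp [map_sum, partialDeriv]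
  rw [this, Finset.sum_mul]
  refine (norm_sum_le _ _).trans (Finset.sum_le_sum fun i _ => ?_)
  rw [norm_mul, mul_comm]
  exact mul_le_mul (hB i) (PiLp.norm_apply_le v i) (norm_nonneg _) (hB0 i)

theorem exists_ae_abs_le_of_memLp_top {Ω : Set (E d)} {v : E d → ℝ}
    (hv : MemLp v ∞ (volume.restrict Ω)) :
    ∃ B : ℝ, 0 ≤ B ∧ ∀ᵐ y ∂(volume.restrict Ω), |v y| ≤ B := by
  refine ⟨(eLpNorm v ∞ (volume.restrict Ω)).toReal, ENNReal.toReal_nonneg, ?_⟩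
  rw [eLpNorm_exponent_top]
  have hfin : eLpNormEssSup v (volume.restrict Ω) ≠ ⊤ := by
    rw [← eLpNorm_exponent_top]; exact hv.2.ne
  filter_upwards [ae_le_eLpNormEssSup (f := v) (μ := volume.restrict Ω)] with y hy
  rw [← Real.norm_eq_abs, ← toReal_enorm]
  exact ENNReal.toReal_mono hfin hy

theorem integrableOn_of_memLp_top {Ω : Set (E d)} (hb : Bornology.IsBounded Ω) {v : E d → ℝ}
    (hv : MemLp v ∞ (volume.restrict Ω)) : IntegrableOn v Ω := by
  have : IsFiniteMeasure (volume.restrict Ω) := ⟨by simpa using hb.measure_lt_top⟩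
  exact hv.integrable le_top

/-- Functions with bounded first weak derivatives have a representative that is Lipschitz along
segments. -/
theorem MemSobolev.exists_segmentLipschitz {Ω : Set (E d)} (hΩ : IsOpen Ω)
    (hb : Bornology.IsBounded Ω) {m : ℕ} (hm : 1 ≤ m) {u : E d → ℝ} (hu : MemSobolev Ω m ∞ u) :
    ∃ (U : E d → ℝ) (L : ℝ), 0 ≤ L ∧ U =ᵐ[volume.restrict Ω] u ∧ SegmentLipschitz Ω L U := by
  have huint := integrableOn_of_memLp_top hb hu.memLp
  have hΩm := hΩ.measurableSet
  have hder : ∀ i : Fin d, ∃ v, HasWeakDeriv Ω (Pi.single i 1) u v ∧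
      MemLp v ∞ (volume.restrict Ω) := fun i => hu.deriv _ (by simpa using hm)
  choose v hv hvLp using hder
  choose B hB0 hB using fun i => exists_ae_abs_le_of_memLp_top (hvLp i)
  obtain ⟨M, hM0, hM⟩ := exists_ae_abs_le_of_memLp_top hu.memLp
  have hε : ∀ n : ℕ, (0 : ℝ) < 1 / ((n : ℝ) + 1) := fun n => by positivity
  set φ : ℕ → ContDiffBump (0 : E d) := fun n => mollifier d _ (hε n) with hφ
  set W : ℕ → E d → ℝ := fun n => mollify Ω ((φ n).normed volume) u with hW
  have hrOut : Tendsto (fun n => (φ n).rOut) atTop (𝓝 0) := tendsto_one_div_add_atTop_nhds_zero_nat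
  -- The mollifications are bounded by M, so an ultrafilter limit exists at every x and defines U
  -- everywhere.
  have hex : ∀ x, ∃ a, Tendsto (fun n => W n x) (hyperfilter ℕ) (𝓝 a) := by
    intro x
    obtain ⟨a, -, ha⟩ := (isCompact_Icc (a := -M) (b := M)).ultrafilter_le_nhds'
      ((hyperfilter ℕ).map fun n => W n x)
      (Ultrafilter.mem_map.2 (univ_mem' fun n => abs_le.1 (abs_mollify_le hM0 hM (φ n) x)))
    exact ⟨a, ha⟩
  choose U hU using hex
  have hle : (hyperfilter ℕ : Filter ℕ) ≤ atTop := Nat.hyperfilter_le_atTop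
  -- A crude gradient bound suffices, since L does not enter the final constant.
  refine ⟨U, ∑ i, B i, Finset.sum_nonneg fun i _ => hB0 i, ?_, ?_⟩
  · have hae := ContDiffBump.ae_convolution_tendsto_right_of_locallyIntegrable (K := 2)
      (g := Ω.indicator u) hrOut
      (Eventually.of_forall fun n => le_of_eq (by simp [hφ, mollifier]; ring))
      ((integrable_indicator_iff hΩm).2 huint).locallyIntegrable (μ := volume)
    rw [Filter.EventuallyEq, ae_restrict_iff' hΩm]
    filter_upwards [hae] with x hx hxΩ
    simp only [← mollify_eq_convolution_swap hΩm, indicator_of_mem hxΩ] at hx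
    exact tendsto_nhds_unique (hU x) (hx.mono_left hle)
  · intro x y hxy
    have hcomp : IsCompact (segment ℝ x y) := by
      rw [segment_eq_image']
      exact isCompact_Icc.image (by fun_prop)
    obtain ⟨δ, hδ, hδΩ⟩ := hcomp.exists_cthickening_subset_open hΩ hxy
    -- Once the kernel radius is below δ, the gradient of `W n` on the segment is the mollified weak
    -- gradient.
    have hev : ∀ᶠ n in (hyperfilter ℕ : Filter ℕ), |W n x - W n y| ≤ (∑ i, B i) * ‖x - y‖ := by
      filter_upwards [(hrOut.mono_left hle).eventually (gt_mem_nhds hδ)] with n hn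
      rw [← Real.norm_eq_abs]
      have hWs : ContDiff ℝ ∞ (W n) :=
        contDiff_mollify hΩm huint (φ n).contDiff_normed (φ n).hasCompactSupport_normed
      refine (convex_segment x y).norm_image_sub_le_of_norm_fderiv_le (𝕜 := ℝ) (f := W n)
        (fun z _ => (hWs.differentiable (by simp)).differentiableAt) (fun z hz => ?_)
        (right_mem_segment ℝ x y) (left_mem_segment ℝ x y)
      refine norm_fderiv_le_sum fun i => ?_
      have hball : Metric.closedBall z (φ n).rOut ⊆ Ω :=
        (Metric.closedBall_subset_cthickening hz _).trans
          ((Metric.cthickening_mono hn.le _).trans hδΩ)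
      have := (hv i).iterate_partialDeriv_mollify hΩm huint (φ n).contDiff_normed
        ((φ n).tsupport_normed_eq (μ := volume)).subset hball
      rw [Function.iterate_one] at this
      rw [hW, this]
      exact abs_mollify_le (hB0 i) (hB i) (φ n) z
    exact le_of_tendsto ((hU x).sub (hU y)).abs hev

/-- Smooth approximation, uniform on compact sets, with control of the Laplacian. -/
theorem MemSobolev.exists_smooth_approx {Ω : Set (E d)} (hΩ : IsOpen Ω)
    (hb : Bornology.IsBounded Ω) {m : ℕ} (hm : 2 ≤ m) {u U : E d → ℝ} (hu : MemSobolev Ω m ∞ u)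
    (hUu : U =ᵐ[volume.restrict Ω] u) {L : ℝ} (hL : 0 ≤ L) (hU : SegmentLipschitz Ω L U)
    {F : ℝ} (hF0 : 0 ≤ F) (hF : ∀ᵐ y ∂(volume.restrict Ω), |weakLaplacian Ω u y| ≤ F)
    {K : Set (E d)} (hK : K ⊆ Ω) (hKc : IsCompact K) {η : ℝ} (hη : 0 < η) :
    ∃ W : E d → ℝ, ContDiff ℝ ∞ W ∧
      ∀ y ∈ K, |W y - U y| ≤ η ∧ |∑ i, partialDeriv i (partialDeriv i W) y| ≤ F := by
  have huint := integrableOn_of_memLp_top hb hu.memLp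
  have hΩm := hΩ.measurableSet
  obtain ⟨δ, hδ, hδΩ⟩ := hKc.exists_cthickening_subset_open hΩ hK
  -- The first bound keeps the kernel inside Ω; the second makes the oscillation Lε of U at most η,
  -- with L + 1 to allow L = 0.
  set ε := min δ (η / (L + 1)) with hε
  have hε0 : 0 < ε := lt_min hδ (by positivity)
  have hLε : L * ε ≤ η := by
    have : ε ≤ η / (L + 1) := min_le_right _ _
    rw [le_div_iff₀ (by positivity)] at this
    nlinarith
  set φ := mollifier d ε hε0
  have hφε : φ.rOut = ε := rfl
  refine ⟨mollify Ω (φ.normed volume) u,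
    contDiff_mollify hΩm huint φ.contDiff_normed φ.hasCompactSupport_normed, fun y hy => ?_⟩
  have hball : Metric.closedBall y φ.rOut ⊆ Ω :=
    (Metric.closedBall_subset_cthickening hy _).trans
      ((Metric.cthickening_mono (min_le_left _ _) _).trans hδΩ)
  constructor
  · have e1 : mollify Ω (φ.normed volume) u y = mollify Ω (φ.normed volume) U y := by
      refine integral_congr_ae ?_
      filter_upwards [hUu] with z hz
      rw [hz]
    have hmeas : AEStronglyMeasurable (Ω.indicator U) volume := by
      rw [aestronglyMeasurable_indicator_iff hΩm]
      exact hu.memLp.1.congr hUu.symm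
    have h1 := φ.dist_normed_convolution_le (x₀ := y) (ε := η) hmeas fun z hz => by
      have hzΩ : z ∈ Ω := hball (Metric.ball_subset_closedBall hz)
      rw [indicator_of_mem hzΩ, indicator_of_mem (hK hy), Real.dist_eq]
      refine (hU z y ?_).trans (le_trans ?_ hLε)
      · exact ((convex_ball y φ.rOut).segment_subset hz (Metric.mem_ball_self φ.rOut_pos)).trans
          (Metric.ball_subset_closedBall.trans hball)
      · rw [mem_ball_iff_norm, hφε] at hz
        gcongr
    rw [← mollify_eq_convolution_swap hΩm, indicator_of_mem (hK hy), Real.dist_eq, ← e1] at h1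
    exact h1
  -- `weakDeriv` is a choice, so only its defining property is available.
  · have hweak : ∀ i : Fin d, HasWeakDeriv Ω (Pi.single i 2) u (weakDeriv Ω (Pi.single i 2) u) := by
      intro i
      obtain ⟨v, hv, -⟩ := hu.deriv (Pi.single i 2) (by simpa using hm)
      have hex : ∃ v, HasWeakDeriv Ω (Pi.single i 2) u v := ⟨v, hv⟩
      rw [weakDeriv, dif_pos hex]
      exact hex.choose_spec
    have hsum : ∑ i, partialDeriv i (partialDeriv i (mollify Ω (φ.normed volume) u)) y
        = mollify Ω (φ.normed volume) (weakLaplacian Ω u) y := by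
      simp only [mollify, weakLaplacian, Finset.sum_mul]
      rw [integral_finsetSum _ fun i _ => integrableOn_mul_comp_sub (hweak i).right
        φ.continuous_normed (φ.tsupport_normed_eq (μ := volume)).subset hball]
      refine Finset.sum_congr rfl fun i _ => ?_
      exact (hweak i).iterate_partialDeriv_mollify hΩm huint φ.contDiff_normed
        (φ.tsupport_normed_eq (μ := volume)).subset hball
    rw [hsum]
    exact abs_mollify_le hF0 hF φ y

/-! ### Boundary values and the estimate -/

theorem SegmentLipschitz.continuousOn {Ω : Set (E d)} (hΩ : IsOpen Ω) {L : ℝ} {U : E d → ℝ}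
    (hU : SegmentLipschitz Ω L U) : ContinuousOn U Ω := by
  intro x hx
  apply ContinuousAt.continuousWithinAt
  obtain ⟨r, hr, hrΩ⟩ := Metric.isOpen_iff.1 hΩ x hx
  rw [ContinuousAt, tendsto_iff_norm_sub_tendsto_zero]
  have hlim : Tendsto (fun y => L * ‖y - x‖) (𝓝 x) (𝓝 0) := by
    have : Continuous fun y => L * ‖y - x‖ := by fun_prop
    simpa using this.tendsto x
  refine squeeze_zero' (Eventually.of_forall fun _ => norm_nonneg _) ?_ hlim
  filter_upwards [Metric.ball_mem_nhds x hr] with y hy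
  exact hU y x (((convex_ball x r).segment_subset hy (Metric.mem_ball_self hr)).trans hrΩ)

/-- At a point where the trace exists, its value is approximated by values at nearby points. -/
theorem exists_abs_sub_le_of_tendsto_laverage {Ω : Set (E d)} (hΩ : IsOpen Ω)
    {u U : E d → ℝ} (hu : AEStronglyMeasurable u (volume.restrict Ω))
    (hUu : U =ᵐ[volume.restrict Ω] u) {x : E d} (hx : x ∈ closure Ω) {c : ℝ}
    (h : Tendsto (fun r : ℝ => ⨍⁻ y in Ω ∩ Metric.ball x r, ‖u y - c‖ₑ ∂volume) (𝓝[>] 0) (𝓝 0))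
    {ρ η : ℝ} (hρ : 0 < ρ) (hη : 0 < η) :
    ∃ z ∈ Ω ∩ Metric.ball x ρ, |U z - c| ≤ η := by
  have hev := h.eventually (gt_mem_nhds (ENNReal.ofReal_pos.2 hη))
  obtain ⟨r, ⟨hr, hr0⟩, hrρ⟩ := ((hev.and self_mem_nhdsWithin).and
    (nhdsWithin_le_nhds (gt_mem_nhds hρ))).exists
  have hr0 : 0 < r := hr0
  set S := Ω ∩ Metric.ball x r with hS
  have hSo : IsOpen S := hΩ.inter Metric.isOpen_ball
  have hSne : S.Nonempty := by
    obtain ⟨z, hz, hz'⟩ := Metric.mem_closure_iff.1 hx r hr0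
    exact ⟨z, hz, by rwa [Metric.mem_ball, dist_comm]⟩
  have hSpos : volume.restrict S ≠ 0 := by
    rw [Ne, Measure.restrict_eq_zero]
    exact (hSo.measure_pos volume hSne).ne'
  have hfin : IsFiniteMeasure (volume.restrict S) :=
    ⟨by simpa using (Metric.isBounded_ball.subset inter_subset_right).measure_lt_top⟩
  have hle : volume.restrict S ≤ volume.restrict Ω := Measure.restrict_mono inter_subset_left le_rfl
  have hmeas : AEMeasurable (fun y => ‖u y - c‖ₑ) (volume.restrict S) :=
    ((hu.mono_measure hle).sub aestronglyMeasurable_const).enorm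
  have hnull : ∀ᵐ y ∂(volume.restrict S), y ∈ S ∧ U y = u y :=
    (ae_restrict_mem hSo.measurableSet).and (ae_mono hle hUu)
  -- Some point has integrand at most the mean, and it can be taken off the null set where U and u
  -- differ.
  obtain ⟨z, hz, hzle⟩ := exists_notMem_null_le_laverage hSpos hmeas hnull
  simp only [mem_compl_iff, mem_ofPred_eq, not_not] at hz
  refine ⟨z, ⟨hz.1.1, Metric.ball_subset_ball hrρ.le hz.1.2⟩, ?_⟩
  rw [hz.2, ← Real.norm_eq_abs, ← ENNReal.ofReal_le_ofReal_iff hη.le, ofReal_norm]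
  exact hzle.trans hr.le

/-- Positive surface measure supplies a boundary point x near x₀ with a trace value bounded by G; a
nearby z in Ω has U z close to g x, and the local Lipschitz bound carries this to y. -/
theorem eventually_abs_le_near_boundary (hd : 1 ≤ d) {Ω : Set (E d)} (hΩ : IsOpen Ω)
    (hlip : HasLipschitzBoundary Ω) {u U g : E d → ℝ}
    (hu : AEStronglyMeasurable u (volume.restrict Ω)) (hUu : U =ᵐ[volume.restrict Ω] u)
    {L : ℝ} (hL : 0 ≤ L) (hU : SegmentLipschitz Ω L U) (hg : HasTrace Ω u g) {G : ℝ}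
    (hG : ∀ᵐ x ∂(surfaceMeasure Ω), |g x| ≤ G) {x₀ : E d} (hx₀ : x₀ ∈ frontier Ω) {η : ℝ}
    (hη : 0 < η) : ∀ᶠ y in 𝓝 x₀, y ∈ Ω → |U y| ≤ G + η := by
  obtain ⟨ρ₀, hρ₀, C, hC, hUC⟩ := hU.lipschitz_near_boundary hL hlip hx₀
  -- Half of η pays for the oscillation C·2ρ of U on the ball, the other half for |U z - g x|.
  set ρ := min ρ₀ (η / (4 * (C + 1))) with hρdef
  have hρ : 0 < ρ := lt_min hρ₀ (by positivity)
  have hCρ : C * (2 * ρ) ≤ η / 2 := by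
    have : ρ ≤ η / (4 * (C + 1)) := min_le_right _ _
    rw [le_div_iff₀ (by positivity)] at this
    nlinarith
  have hmem : ∀ᵐ x ∂(surfaceMeasure Ω), x ∈ frontier Ω :=
    ae_restrict_mem isClosed_frontier.measurableSet
  have hpos := surfaceMeasure_ball_pos hd hΩ hlip hx₀ hρ
  obtain ⟨x, hxb, hxf, hxg, hxG⟩ : ∃ x ∈ Metric.ball x₀ ρ, x ∈ frontier Ω ∧
      Tendsto (fun r : ℝ => ⨍⁻ y in Ω ∩ Metric.ball x r, ‖u y - g x‖ₑ ∂volume) (𝓝[>] 0) (𝓝 0) ∧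
      |g x| ≤ G := by
    by_contra! hno
    refine hpos.ne' (measure_mono_null ?_ (hmem.and (hg.and hG)))
    intro x hx hx'
    exact absurd hx'.2.2 (not_le.2 (hno x hx hx'.1 hx'.2.1))
  obtain ⟨r, hr, hrb⟩ := Metric.isOpen_iff.1 Metric.isOpen_ball x hxb
  obtain ⟨z, hz, hzg⟩ := exists_abs_sub_le_of_tendsto_laverage hΩ hu hUu
    (frontier_subset_closure hxf) hxg hr (half_pos hη)
  have hzb : z ∈ Metric.ball x₀ ρ := hrb hz.2
  have hsub : Metric.ball x₀ ρ ⊆ Metric.ball x₀ ρ₀ := Metric.ball_subset_ball (min_le_left _ _)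
  filter_upwards [Metric.ball_mem_nhds x₀ hρ] with y hy hyΩ
  have h1 := hUC y ⟨hyΩ, hsub hy⟩ z ⟨hz.1, hsub hzb⟩
  have h2 : ‖y - z‖ ≤ 2 * ρ := by
    rw [← dist_eq_norm]
    have := dist_triangle_right y z x₀
    rw [Metric.mem_ball] at hy hzb
    linarith
  have h3 : C * ‖y - z‖ ≤ C * (2 * ρ) := by gcongr
  rw [abs_le] at h1 hzg hxG ⊢
  constructor <;> linarith [h1.1, h1.2, hzg.1, hzg.2, hxG.1, hxG.2]

theorem partialDeriv_neg (i : Fin d) (W : E d → ℝ) :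
    partialDeriv i (fun y => -W y) = fun y => -partialDeriv i W y := by
  ext y
  simp [partialDeriv, fderiv_fun_neg]

/-- The pointwise estimate: `|u| ≤ (1 + diam² Ω) N` if `|Δu| ≤ N` and `|u| ≤ N` on `∂Ω`. -/
theorem MemSobolev.ae_abs_le (hd : 1 ≤ d) {Ω : Set (E d)} (hΩ : IsOpen Ω)
    (hb : Bornology.IsBounded Ω) (hlip : HasLipschitzBoundary Ω) {m : ℕ} (hm : 2 ≤ m)
    {u g : E d → ℝ} (hu : MemSobolev Ω m ∞ u) (hg : HasTrace Ω u g) {N : ℝ} (hN : 0 ≤ N)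
    (hΔ : ∀ᵐ y ∂(volume.restrict Ω), |weakLaplacian Ω u y| ≤ N)
    (hgN : ∀ᵐ x ∂(surfaceMeasure Ω), |g x| ≤ N) :
    ∀ᵐ y ∂(volume.restrict Ω), |u y| ≤ N + N * Metric.diam Ω ^ 2 := by
  obtain ⟨U, L, hL, hUu, hU⟩ := hu.exists_segmentLipschitz hΩ hb (by omega)
  have hUc := hU.continuousOn hΩ
  have hbd := fun x (hx : x ∈ frontier Ω) (η : ℝ) (hη : η > 0) =>
    eventually_abs_le_near_boundary hd hΩ hlip hu.memLp.1 hUu hL hU hg hgN hx hη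
  have happ := fun (K : Set (E d)) (hK : K ⊆ Ω) (hKc : IsCompact K) (η : ℝ) (hη : η > 0) =>
    hu.exists_smooth_approx hΩ hb hm hUu hL hU hN hΔ hK hKc hη
  filter_upwards [hUu, ae_restrict_mem hΩ.measurableSet] with y hy hyΩ
  rw [← hy, abs_le']
  constructor
  · refine le_of_smooth_approx_of_boundary_le hd hΩ hb hUc hN ?_ ?_ hyΩ
    · intro K hK hKc η hη
      obtain ⟨W, hW, hWK⟩ := happ K hK hKc η hη
      exact ⟨W, hW, fun z hz => ⟨(hWK z hz).1, (abs_le.1 (hWK z hz).2).1⟩⟩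
    · intro x hx η hη
      filter_upwards [hbd x hx η hη] with z hz hzΩ using (abs_le.1 (hz hzΩ)).2
  · refine le_of_smooth_approx_of_boundary_le (V := fun z => -U z) hd hΩ hb hUc.neg hN ?_ ?_ hyΩ
    · intro K hK hKc η hη
      obtain ⟨W, hW, hWK⟩ := happ K hK hKc η hη
      refine ⟨fun z => -W z, hW.neg, fun z hz => ⟨?_, ?_⟩⟩
      · rw [neg_sub_neg, abs_sub_comm]
        exact (hWK z hz).1
      · simp only [partialDeriv_neg, Finset.sum_neg_distrib]
        exact neg_le_neg (abs_le.1 (hWK z hz).2).2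
    · intro x hx η hη
      filter_upwards [hbd x hx η hη] with z hz hzΩ
      linarith [(abs_le.1 (hz hzΩ)).1]

/-! ### From the pointwise bound to the L_2 bound -/

theorem ae_abs_le_toReal_of_eLpNorm_top_le {μ : Measure (E d)} {v : E d → ℝ} {N : ℝ≥0∞}
    (hN : N ≠ ⊤) (hv : eLpNorm v ∞ μ ≤ N) : ∀ᵐ y ∂μ, |v y| ≤ N.toReal := by
  rw [eLpNorm_exponent_top] at hv
  filter_upwards [ae_le_eLpNormEssSup (f := v) (μ := μ)] with y hy
  rw [← Real.norm_eq_abs, ← toReal_enorm]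
  exact ENNReal.toReal_mono hN (hy.trans hv)

/-- The constant of the estimate, a function of the diameter. -/
def poissonConstant (Ω : Set (E d)) : ℝ≥0 :=
  (volume (Metric.closedBall (0 : E d) (Metric.diam Ω)) ^ (2 : ℝ)⁻¹ *
    ENNReal.ofReal (1 + Metric.diam Ω ^ 2)).toNNReal + 1

/-- The ball in the constant is centred at 0, so Ω enters only through its diameter. -/
theorem poissonConstant_image (T : E d ≃ᵢ E d) (Ω : Set (E d)) :
    poissonConstant (T '' Ω) = poissonConstant Ω := by
  rw [poissonConstant, poissonConstant, T.isometry.diam_image]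

theorem volume_le_volume_closedBall_diam {Ω : Set (E d)} (hb : Bornology.IsBounded Ω) :
    volume Ω ≤ volume (Metric.closedBall (0 : E d) (Metric.diam Ω)) := by
  rcases Ω.eq_empty_or_nonempty with rfl | ⟨x, hx⟩
  · simp
  · rw [← Measure.addHaar_closedBall_center volume x]
    exact measure_mono fun y hy => Metric.dist_le_diam_of_mem hb hy hx

theorem eLpNorm_le_poissonConstant_mul {Ω : Set (E d)} (hb : Bornology.IsBounded Ω)
    {u : E d → ℝ} {N : ℝ≥0∞} (hN : N ≠ ⊤)
    (hu : ∀ᵐ y ∂(volume.restrict Ω), |u y| ≤ N.toReal + N.toReal * Metric.diam Ω ^ 2) :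
    eLpNorm u 2 (volume.restrict Ω) ≤ poissonConstant Ω * N := by
  set D := Metric.diam Ω
  set A := volume (Metric.closedBall (0 : E d) D) ^ (2 : ℝ)⁻¹ * ENNReal.ofReal (1 + D ^ 2) with hA
  have hAfin : A ≠ ⊤ := ENNReal.mul_ne_top
    (ENNReal.rpow_ne_top_of_nonneg (by norm_num) measure_closedBall_lt_top.ne) ENNReal.ofReal_ne_top
  have hAC : A ≤ (poissonConstant Ω : ℝ≥0∞) := by
    rw [poissonConstant, ENNReal.coe_add, ENNReal.coe_toNNReal hAfin]
    exact le_self_add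
  calc eLpNorm u 2 (volume.restrict Ω)
      ≤ (volume.restrict Ω) univ ^ (2 : ℝ≥0∞).toReal⁻¹ *
          ENNReal.ofReal (N.toReal + N.toReal * D ^ 2) := eLpNorm_le_of_ae_bound hu
    _ = volume Ω ^ (2 : ℝ)⁻¹ * (N * ENNReal.ofReal (1 + D ^ 2)) := by
        rw [Measure.restrict_apply_univ, show N.toReal + N.toReal * D ^ 2 = N.toReal * (1 + D ^ 2)
          by ring, ENNReal.ofReal_mul ENNReal.toReal_nonneg, ENNReal.ofReal_toReal hN]
        simp
    _ ≤ volume (Metric.closedBall (0 : E d) D) ^ (2 : ℝ)⁻¹ *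
          (N * ENNReal.ofReal (1 + D ^ 2)) := by
        have := volume_le_volume_closedBall_diam hb
        gcongr ?_ ^ _ * _
    _ = A * N := by rw [hA]; ring
    _ ≤ poissonConstant Ω * N := by gcongr

end PoissonEstimate

end

/-- The constant `C_P Ω` depends only on the shape and size of `Ω`: it is a function of the set
`Ω` alone, and it takes the same value at congruent sets. -/
theorem mainTheorem2 (d : ℕ) (hd : 1 ≤ d) :
    ∃ C_P : Set (PoissonEstimate.E d) → ℝ≥0,
      (∀ (T : PoissonEstimate.E d ≃ᵢ PoissonEstimate.E d) (Ω : Set (PoissonEstimate.E d)),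
        C_P (T '' Ω) = C_P Ω) ∧
      ∀ Ω : Set (PoissonEstimate.E d), PoissonEstimate.IsAdmissibleDomain Ω →
        ∀ m : ℕ, 2 ≤ m → ∀ f g u : PoissonEstimate.E d → ℝ,
          PoissonEstimate.MemSobolev Ω m ∞ u →
          PoissonEstimate.IsPoissonSolution Ω f g u →
            eLpNorm u 2 (volume.restrict Ω) ≤ C_P Ω * PoissonEstimate.dataNorm Ω u := by
  open PoissonEstimate in
  refine ⟨poissonConstant, poissonConstant_image, fun Ω hΩ m hm f g u hu hsol => ?_⟩
  -- Since 0 · ∞ = 0, this case needs a nonzero constant, which the final + 1 in `poissonConstant`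
  -- secures.
  by_cases hN : dataNorm Ω u = ⊤
  · have hC : (poissonConstant Ω : ℝ≥0∞) ≠ 0 := by simp [poissonConstant]
    rw [hN, ENNReal.mul_top hC]
    exact le_top
  -- The chosen trace is itself a trace because g witnesses existence; uniqueness is not needed.
  have htrace : HasTrace Ω u (boundaryTrace Ω u) := by
    have hex : ∃ g, HasTrace Ω u g := ⟨g, hsol.boundary⟩
    rw [boundaryTrace, dif_pos hex]
    exact hex.choose_spec
  exact eLpNorm_le_poissonConstant_mul hΩ.isBounded hN <|
    hu.ae_abs_le hd hΩ.isOpen hΩ.isBounded hΩ.lipschitz hm htrace ENNReal.toReal_nonneg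
      (ae_abs_le_toReal_of_eLpNorm_top_le hN (le_max_left _ _))
      (ae_abs_le_toReal_of_eLpNorm_top_le hN (le_max_right _ _))
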